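/- Let $\mathbf X$ be a set (for instance a subset of $\mathbb R^n$), let $\mathcal F$ be a reproducing kernel Hilbert space of real functions on $\mathbf X$ with kernel $k$, and assume $c_{\mathcal F}^2=\sup_{x\in\mathbf X}k(x,x)<\infty$ (with $c_{\mathcal F}\ge 0$). Let $[Y_1,Y_2]\subset\mathbb R$ be the outcome set. In each step $t=1,2,\dots$ Accountant announces a discount factor $\alpha_{t-1}\in(0,1]$, Reality announces an input $x_t\in\mathbf X$, Learner announces a prediction $\gamma_t\in\mathbb R$, and Reality announces an outcome $y_t\in[Y_1,Y_2]$. Put $\beta_t=1/(\alpha_1\cdots\alpha_{t-1})$ (so $\beta_1=1$). For $a>0$ let $S_a$ be the strategy for Learner that predicts at step $T$ $$\gamma_T=\Bigl(y_1,\dots,y_{T-1},\tfrac{Y_1+Y_2}{2}\Bigr)\sqrt{W_T}\,\bigl(aI+\sqrt{W_T}\,K_T\sqrt{W_T}\bigr)^{-1}\sqrt{W_T}\,k_T,$$ where $W_T=\mathrm{diag}(\beta_1/\beta_T,\dots,\beta_T/\beta_T)$, $K_T=(k(x_i,x_j))_{i,j=1}^{T}$, and $k_T=(k(x_i,x_T))_{i=1}^T$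 is a column vector. Then for every constant $\mathcal T>0$, given in advance, there is a parameter $a>0$, namely $a=c_{\mathcal F}\sqrt{\mathcal T}$ whenever $c_{\mathcal F}>0$, such that if Learner follows $S_a$, then, for all moves of Accountant and Reality, for every positive integer $T$ with $\bigl(\sum_{t=1}^T\beta_t\bigr)/\beta_T\le\mathcal T$ and for every $f\in\mathcal F$, $$\sum_{t=1}^T\frac{\beta_t}{\beta_T}(\gamma_t-y_t)^2\le\sum_{t=1}^T\frac{\beta_t}{\beta_T}(f(x_t)-y_t)^2+\left(\frac{(Y_2-Y_1)^2}{4}+\|f\|^2\right)c_{\mathcal F}\sqrt{\mathcal T}.$$ -/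

import Mathlib

/-!
Discounted online regression with the square loss.  Rounds are numbered from zero: round `n` of the
formalization is step `n + 1` of the usual numbering, so that "after `T` steps" (with `T ≥ 1`) reads
"after round `N`", where `T = N + 1`.

In round `n`: Accountant announces the discount factor `α n ∈ (0,1]`, Reality announces an input
`x n`, Learner announces a prediction, and Reality announces the outcome `y n`.
-/

/-- The scalar kernel `k(x, x')` of a real reproducing kernel Hilbert space `F` of functions
`X → ℝ`: the value at `1` of the corresponding entry (a linear map `ℝ → ℝ`) of Mathlib's kernel. -/
noncomputable def rkhsKernel {X : Type*} (F : Type*) [NormedAddCommGroup F] [InnerProductSpace ℝ F]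
    [CompleteSpace F] [RKHS ℝ F X ℝ] (x x' : X) : ℝ :=
  RKHS.kernel F x x' (1 : ℝ)

/-- The weight `1 / (α₁ ⋯ αₜ)` that the discount factors `α` give to round `t` (so round `0` has
weight `1`; the factor `α₀`, which discounts the empty past, plays no role).  The index type is `ℕ`
for a whole play and `Fin (n + 1)` for the part of a play that is known in round `n`. -/
noncomputable def discountWeight {ι : Type*} [Preorder ι] [LocallyFiniteOrder ι] [Zero ι]
    (α : ι → ℝ) (t : ι) : ℝ :=
  ∏ i ∈ Finset.Ioc 0 t, (α i)⁻¹

/-- A (deterministic) strategy for Learner: in round `n` the prediction is a function of the discount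
factors and the inputs of rounds `0, …, n` and of the outcomes of rounds `0, …, n - 1`. -/
abbrev RegressionStrategy (X : Type*) : Type _ :=
  (n : ℕ) → (Fin (n + 1) → ℝ) → (Fin (n + 1) → X) → (Fin n → ℝ) → ℝ

/-- The prediction that Learner announces in round `n` when he follows the strategy `S` and the other
players announce `α`, `x`, `y`. -/
def RegressionStrategy.predict {X : Type*} (S : RegressionStrategy X)
    (α : ℕ → ℝ) (x : ℕ → X) (y : ℕ → ℝ) (n : ℕ) : ℝ :=
  S n (fun i => α i) (fun i => x i) (fun i => y i)

open scoped Matrix in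
/-- The Aggregating Algorithm for Regression with discounting for the kernel `k`, the outcome set
`[Y₁, Y₂]` and the regularization parameter `a`.  It predicts
`(Y; (Y₁ + Y₂) / 2)' √W (a I + √W K √W)⁻¹ √W κ`,
where `Y` is the vector of past outcomes, `W` is the diagonal matrix of the normalized discount
weights, `K` is the kernel matrix of the inputs and `κ` is its last column. -/
noncomputable def kernelStrategy {X : Type*} (k : X → X → ℝ) (Y₁ Y₂ a : ℝ) : RegressionStrategy X :=
  fun n α x y =>
    let sqrtW : Matrix (Fin (n + 1)) (Fin (n + 1)) ℝ :=
      Matrix.diagonal fun s => √(discountWeight α s / discountWeight α (Fin.last n))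
    let K : Matrix (Fin (n + 1)) (Fin (n + 1)) ℝ := Matrix.of fun i j => k (x i) (x j)
    let κ : Fin (n + 1) → ℝ := fun i => k (x i) (x (Fin.last n))
    let Y : Fin (n + 1) → ℝ := Fin.snoc (α := fun _ => ℝ) y ((Y₁ + Y₂) / 2)
    Y ⬝ᵥ (sqrtW *ᵥ ((a • (1 : Matrix (Fin (n + 1)) (Fin (n + 1)) ℝ) + sqrtW * K * sqrtW)⁻¹ *ᵥ
      (sqrtW *ᵥ κ)))

/-- The discounted square loss after round `N` of the predictions `p` for the outcomes `y`, that is,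
`∑_{t ≤ N} (β_t / β_N) (p_t - y_t)²` with `β = discountWeight α`. -/
noncomputable def discountedSquareLoss (α p y : ℕ → ℝ) (N : ℕ) : ℝ :=
  ∑ t ∈ Finset.range (N + 1), discountWeight α t / discountWeight α N * (p t - y t) ^ 2

/-! Induction on rounds with unnormalized weights `β`: the learner's loss minus an accumulated error
is at most every regularized loss. In round `n` the ridge parameter is `a β_n`; since `β` is
nondecreasing, raising it only weakens the previous bound. The prediction is ridge regression with
the unknown outcome replaced by the centre of `[Y₁, Y₂]`, and `aggregating_step` shows that this
costs at most `D β_n² C / (a β_n) = D (C / a) β_n`, where `D = (Y₂ - Y₁)² / 4` and `C` bounds the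
kernel diagonal. Summing and dividing by `β_N` leaves `a ‖f‖² + D (C / a) 𝒯`, and `a = c √𝒯`, `C =
c²` makes both coefficients `c √𝒯`. -/

/-! ### One round in a Hilbert space -/

open scoped RealInnerProductSpace in
/-- The regularized normal equations `(ρ + ∑ w t • v t ⊗ v t) g = b` have a solution, here in weak
form. -/
theorem exists_normal_equations_solution {E ι : Type*} [NormedAddCommGroup E]
    [InnerProductSpace ℝ E] [CompleteSpace E] (s : Finset ι) (w : ι → ℝ) (v : ι → E)
    (hw : ∀ t ∈ s, 0 ≤ w t) {ρ : ℝ} (hρ : 0 < ρ) (b : E) :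
    ∃ g : E, ∀ d : E, ∑ t ∈ s, w t * (⟪v t, g⟫ * ⟪v t, d⟫) + ρ * ⟪g, d⟫ = ⟪b, d⟫ := by
  let I : E →L[ℝ] E →L[ℝ] ℝ := innerSL ℝ
  let A : E →L[ℝ] E →L[ℝ] ℝ :=
    ∑ t ∈ s, w t • (innerSL ℝ (v t)).smulRight (innerSL ℝ (v t)) + ρ • I
  have hA : ∀ g d, A g d = ∑ t ∈ s, w t * (⟪v t, g⟫ * ⟪v t, d⟫) + ρ * ⟪g, d⟫ := by
    intro g d
    simp [A, I]
    exact Or.inl rfl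
  have hco : IsCoercive A := by
    refine ⟨ρ, hρ, fun g => ?_⟩
    rw [hA, real_inner_self_eq_norm_mul_norm]
    have : 0 ≤ ∑ t ∈ s, w t * (⟪v t, g⟫ * ⟪v t, g⟫) :=
      Finset.sum_nonneg fun t ht => mul_nonneg (hw t ht) (mul_self_nonneg _)
    linarith
  -- Lax–Milgram.
  refine ⟨hco.continuousLinearEquivOfBilin.symm b, fun d => ?_⟩
  rw [← hA, ← hco.continuousLinearEquivOfBilin_apply, ContinuousLinearEquiv.apply_symm_apply]

/-- The scalar inequality behind one round of the Aggregating Algorithm for Regression: `q` is the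
residual of the ridge prediction that ignores the current round, `r` the deviation of the outcome
from the centre, `σ` the posterior variance. -/
theorem aggregating_step_scalar {b σ p e q r D : ℝ} (hb : 0 ≤ b) (hσ : 0 ≤ σ) (he : 0 ≤ e)
    (hp : p ^ 2 ≤ σ * e) (hD : r ^ 2 ≤ D) :
    b * ((q - b * σ * r) / (1 + b * σ)) ^ 2 ≤ e + b * (q + p) ^ 2 + D * (b ^ 2 * σ) := by
  have hu : 0 ≤ b * σ := mul_nonneg hb hσ
  -- For `σ > 0` the left side is the minimum over `p` of `p² / σ + b (q + p)²`.
  have h1 : b * q ^ 2 / (1 + b * σ) ≤ e + b * (q + p) ^ 2 := by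
    rw [div_le_iff₀ (by linarith)]
    rcases hσ.eq_or_lt with rfl | hσ
    · have : p = 0 := by nlinarith
      subst this
      nlinarith
    · refine le_of_mul_le_mul_left ?_ hσ
      have h2 : 0 ≤ b * (p + b * σ * (q + p)) ^ 2 := mul_nonneg hb (sq_nonneg _)
      have h3 : p ^ 2 * (1 + b * σ) ≤ σ * e * (1 + b * σ) := by gcongr
      nlinarith [mul_nonneg hb (sq_nonneg (p + b * σ * (q + p))), sq_nonneg (p + b * σ * (q + p))]
  -- Convexity of the square: the fraction is a weighted mean of `q` and `-r`.
  have h2 : ((q - b * σ * r) / (1 + b * σ)) ^ 2 ≤ q ^ 2 / (1 + b * σ) + D * (b * σ) := by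
    have h3 : ((q - b * σ * r) / (1 + b * σ)) ^ 2 =
        q ^ 2 / (1 + b * σ) + r ^ 2 * (b * σ) - b * σ * (q + r) ^ 2 / (1 + b * σ) ^ 2
          - r ^ 2 * (b * σ) ^ 2 / (1 + b * σ) := by
      field_simp
      ring
    have h4 : 0 ≤ b * σ * (q + r) ^ 2 / (1 + b * σ) ^ 2 := by positivity
    have h5 : 0 ≤ r ^ 2 * (b * σ) ^ 2 / (1 + b * σ) := by positivity
    have h6 : r ^ 2 * (b * σ) ≤ D * (b * σ) := by gcongr
    linarith
  calc b * ((q - b * σ * r) / (1 + b * σ)) ^ 2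
      ≤ b * (q ^ 2 / (1 + b * σ) + D * (b * σ)) := by gcongr
    _ = b * q ^ 2 / (1 + b * σ) + D * (b ^ 2 * σ) := by ring
    _ ≤ _ := by linarith

open scoped RealInnerProductSpace in
/-- One round of the Aggregating Algorithm for Regression in a Hilbert space: if `S` is at most the
regularized loss of every `h` on the past rounds `s`, and `g` solves the ridge regression problem in
which the unknown outcome `z` of the current round is replaced by `m`, then predicting `⟪u, g⟫`
keeps this property up to a term of second order. -/
theorem aggregating_step {E ι : Type*} [NormedAddCommGroup E] [InnerProductSpace ℝ E]
    [CompleteSpace E] (s : Finset ι) (w y : ι → ℝ) (v : ι → E) (hw : ∀ t ∈ s, 0 ≤ w t)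
    {ρ b C D z m S : ℝ} (hρ : 0 < ρ) (hb : 0 ≤ b) {u g : E} (hu : ⟪u, u⟫ ≤ C)
    (hD : (z - m) ^ 2 ≤ D)
    (hg : ρ • g = ∑ t ∈ s, (w t * (y t - ⟪v t, g⟫)) • v t + (b * (m - ⟪u, g⟫)) • u)
    (hS : ∀ h : E, S ≤ ∑ t ∈ s, w t * (⟪v t, h⟫ - y t) ^ 2 + ρ * ⟪h, h⟫) (f : E) :
    S + b * (⟪u, g⟫ - z) ^ 2 ≤
      ∑ t ∈ s, w t * (⟪v t, f⟫ - y t) ^ 2 + b * (⟪u, f⟫ - z) ^ 2 + ρ * ⟪f, f⟫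
        + D * (b ^ 2 * (C / ρ)) := by
  -- `h` is the ridge minimizer on the past; `ψ` represents `⟪u, ·⟫` in the energy form.
  obtain ⟨h, hh⟩ := exists_normal_equations_solution s w v hw hρ (∑ t ∈ s, (w t * y t) • v t)
  obtain ⟨ψ, hψ⟩ := exists_normal_equations_solution s w v hw hρ u
  have hg' : ∀ d, ∑ t ∈ s, w t * (⟪v t, g⟫ * ⟪v t, d⟫) + ρ * ⟪g, d⟫ =
      ⟪∑ t ∈ s, (w t * y t) • v t, d⟫ + b * (m - ⟪u, g⟫) * ⟪u, d⟫ := by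
    intro d
    have := congrArg (fun x => ⟪x, d⟫) hg
    simp only [inner_add_left, sum_inner, real_inner_smul_left] at this ⊢
    rw [this, ← add_assoc, ← Finset.sum_add_distrib]
    congr 1
    exact Finset.sum_congr rfl fun t _ => by ring
  have henergy : ∀ d : E, 0 ≤ ∑ t ∈ s, w t * (⟪v t, d⟫ * ⟪v t, d⟫) := fun d =>
    Finset.sum_nonneg fun t ht => mul_nonneg (hw t ht) (mul_self_nonneg _)
  have hσ : 0 ≤ ⟪u, ψ⟫ := by
    rw [← hψ ψ]
    exact add_nonneg (henergy ψ) (mul_nonneg hρ.le real_inner_self_nonneg)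
  have hσC : ⟪u, ψ⟫ ≤ C / ρ := by
    have h1 : ρ * ⟪ψ, ψ⟫ ≤ ⟪u, ψ⟫ := by linarith [hψ ψ, henergy ψ]
    have h2 : ⟪u, ψ⟫ * ⟪u, ψ⟫ ≤ ⟪u, u⟫ * ⟪ψ, ψ⟫ := real_inner_mul_inner_self_le u ψ
    have h3 : ⟪u, u⟫ * ⟪ψ, ψ⟫ ≤ C * ⟪ψ, ψ⟫ :=
      mul_le_mul_of_nonneg_right hu real_inner_self_nonneg
    have hC : 0 ≤ C := real_inner_self_nonneg.trans hu
    rw [le_div_iff₀ hρ]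
    rcases hσ.eq_or_lt with h0 | h0
    · rw [← h0]; simpa using hC
    · refine le_of_mul_le_mul_left ?_ h0
      calc ⟪u, ψ⟫ * (⟪u, ψ⟫ * ρ) ≤ (C * ⟪ψ, ψ⟫) * ρ := by
            rw [← mul_assoc]; exact mul_le_mul_of_nonneg_right (h2.trans h3) hρ.le
        _ = C * (ρ * ⟪ψ, ψ⟫) := by ring
        _ ≤ C * ⟪u, ψ⟫ := by gcongr
        _ = _ := mul_comm _ _
  set d := f - h with hd
  set e := ∑ t ∈ s, w t * (⟪v t, d⟫ * ⟪v t, d⟫) + ρ * ⟪d, d⟫ with he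
  have he0 : 0 ≤ e := add_nonneg (henergy d) (mul_nonneg hρ.le real_inner_self_nonneg)
  -- Cauchy–Schwarz for the energy form, from the energy of `d - x • ψ`.
  have hcs : ⟪u, d⟫ ^ 2 ≤ ⟪u, ψ⟫ * e := by
    have hq : ∀ x : ℝ, 0 ≤ ⟪u, ψ⟫ * (x * x) + (-2 * ⟪u, d⟫) * x + e := by
      intro x
      have h1 := add_nonneg (henergy (d - x • ψ))
        (mul_nonneg hρ.le (real_inner_self_nonneg (x := d - x • ψ)))
      refine h1.trans_eq ?_
      rw [← hψ ψ, ← hψ d, he]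
      simp only [inner_sub_right, inner_sub_left, real_inner_smul_left, real_inner_smul_right,
        real_inner_comm ψ d]
      have : ∀ t, w t * ((⟪v t, d⟫ - x * ⟪v t, ψ⟫) * (⟪v t, d⟫ - x * ⟪v t, ψ⟫)) =
        w t * (⟪v t, d⟫ * ⟪v t, d⟫) - 2 * x * (w t * (⟪v t, ψ⟫ * ⟪v t, d⟫)) +
          x * x * (w t * (⟪v t, ψ⟫ * ⟪v t, ψ⟫)) := fun t => by ring
      simp only [this, Finset.sum_add_distrib, Finset.sum_sub_distrib, ← Finset.mul_sum]
      ring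
    have := discrim_le_zero hq
    rw [discrim] at this
    linarith
  -- By symmetry of the energy form, the equations for `g` and `h` are tested on `ψ` and conversely.
  have hres : ⟪u, g⟫ - ⟪u, h⟫ = b * (m - ⟪u, g⟫) * ⟪u, ψ⟫ := by
    have h1 := hψ g
    have h2 := hψ h
    have h3 := hg' ψ
    have h4 := hh ψ
    simp only [mul_comm ⟪v _, ψ⟫] at h1 h2
    rw [real_inner_comm] at h1 h2
    linarith
  -- Pythagoras: the normal equations for `h` cancel the cross term.
  have hpyth : ∑ t ∈ s, w t * (⟪v t, f⟫ - y t) ^ 2 + ρ * ⟪f, f⟫ =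
      ∑ t ∈ s, w t * (⟪v t, h⟫ - y t) ^ 2 + ρ * ⟪h, h⟫ + e := by
    have hf : f = h + d := by rw [hd]; abel
    have h1 := hh d
    rw [hf, he]
    simp only [inner_add_right, inner_add_left, sum_inner, real_inner_smul_left,
      real_inner_comm h d] at h1 ⊢
    have : ∀ t, w t * (⟪v t, h⟫ + ⟪v t, d⟫ - y t) ^ 2 = w t * (⟪v t, h⟫ - y t) ^ 2 +
      w t * (⟪v t, d⟫ * ⟪v t, d⟫) + 2 * (w t * (⟪v t, h⟫ * ⟪v t, d⟫)) -
        2 * (w t * y t * ⟪v t, d⟫) := fun t => by ring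
    simp only [this, Finset.sum_add_distrib, Finset.sum_sub_distrib, ← Finset.mul_sum]
    linear_combination 2 * h1
  have hγ : ⟪u, g⟫ - z = (⟪u, h⟫ - z - b * ⟪u, ψ⟫ * (z - m)) / (1 + b * ⟪u, ψ⟫) := by
    have : 0 ≤ b * ⟪u, ψ⟫ := mul_nonneg hb hσ
    rw [eq_div_iff (by linarith)]
    linear_combination hres
  have huf : ⟪u, f⟫ - z = ⟪u, h⟫ - z + ⟪u, d⟫ := by rw [hd, inner_sub_right]; ring
  have hstep := aggregating_step_scalar (q := ⟪u, h⟫ - z) hb hσ he0 hcs hD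
  have hD0 : 0 ≤ D := (sq_nonneg _).trans hD
  have hlast : D * (b ^ 2 * ⟪u, ψ⟫) ≤ D * (b ^ 2 * (C / ρ)) := by gcongr
  rw [hγ, huf]
  linarith [hS h]

/-! ### The matrix formula as ridge regression -/

open scoped Matrix RealInnerProductSpace in
/-- The matrix form `Y' √W (a I + √W K √W)⁻¹ √W κ` of kernel ridge regression computes the value at
`u` of a solution `g` of the regularized normal equations. -/
theorem exists_ridge_of_gram {E ι : Type*} [NormedAddCommGroup E] [InnerProductSpace ℝ E]
    [Fintype ι] [DecidableEq ι] (v : ι → E) (ω Y : ι → ℝ) {a : ℝ} (ha : 0 < a) (u : E) :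
    ∃ g : E, a • g = ∑ i, (ω i ^ 2 * (Y i - ⟪v i, g⟫)) • v i ∧
      Y ⬝ᵥ (Matrix.diagonal ω *ᵥ ((a • (1 : Matrix ι ι ℝ) +
        Matrix.diagonal ω * Matrix.of (fun i j => ⟪v i, v j⟫) * Matrix.diagonal ω)⁻¹ *ᵥ
          (Matrix.diagonal ω *ᵥ fun i => ⟪v i, u⟫))) = ⟪u, g⟫ := by
  set D : Matrix ι ι ℝ := Matrix.diagonal ω with hD
  set K : Matrix ι ι ℝ := Matrix.of (fun i j => ⟪v i, v j⟫) with hK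
  set M : Matrix ι ι ℝ := a • (1 : Matrix ι ι ℝ) + D * K * D with hM
  have hDt : Dᵀ = D := Matrix.diagonal_transpose ω
  have hKpos : K.PosSemidef := Matrix.posSemidef_gram ℝ v
  have hMpos : M.PosDef := by
    refine Matrix.PosDef.add_posSemidef (Matrix.PosDef.one.smul ha) ?_
    have := hKpos.mul_mul_conjTranspose_same D
    rwa [Matrix.conjTranspose_eq_transpose_of_trivial, hDt] at this
  have hMt : Mᵀ = M := by
    rw [← Matrix.conjTranspose_eq_transpose_of_trivial]; exact hMpos.isHermitian
  have hdet : IsUnit M.det := (Matrix.isUnit_iff_isUnit_det M).1 hMpos.isUnit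
  -- Dual coefficients: the solution is sought in the span of the `v j`.
  set e : ι → ℝ := M⁻¹ *ᵥ (D *ᵥ Y) with he
  have hMe : M *ᵥ e = D *ᵥ Y := by
    rw [he, Matrix.mulVec_mulVec, Matrix.mul_nonsing_inv _ hdet, Matrix.one_mulVec]
  have hcoord : ∀ i, a * e i + ω i * ∑ j, ⟪v i, v j⟫ * (ω j * e j) = ω i * Y i := by
    intro i
    have := congrFun hMe i
    rw [hM, Matrix.add_mulVec, Matrix.smul_mulVec, Matrix.one_mulVec, ← Matrix.mulVec_mulVec,
      ← Matrix.mulVec_mulVec] at this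
    simpa [hD, hK, Matrix.mulVec_diagonal, Matrix.mulVec, dotProduct, Matrix.diagonal_apply,
      Finset.mul_sum, mul_assoc] using this
  have hin : ∀ x, ⟪x, ∑ j, (ω j * e j) • v j⟫ = ∑ j, ⟪x, v j⟫ * (ω j * e j) := by
    intro x
    simp only [inner_sum, real_inner_smul_right, mul_comm]
  refine ⟨∑ j, (ω j * e j) • v j, ?_, ?_⟩
  · rw [Finset.smul_sum]
    refine Finset.sum_congr rfl fun i _ => ?_
    rw [smul_smul, hin]
    congr 1
    linear_combination ω i * hcoord i
  · have hsymm : ∀ (N : Matrix ι ι ℝ) (p q : ι → ℝ), Nᵀ = N → p ⬝ᵥ (N *ᵥ q) = (N *ᵥ p) ⬝ᵥ q := by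
      intro N p q hN
      rw [Matrix.dotProduct_mulVec, ← Matrix.mulVec_transpose, hN]
    rw [hsymm D _ _ hDt, hsymm M⁻¹ _ _ (by rw [Matrix.transpose_nonsing_inv, hMt]), ← he,
      hsymm D _ _ hDt, hin]
    simp only [dotProduct, hD, Matrix.mulVec_diagonal]
    refine Finset.sum_congr rfl fun i _ => ?_
    rw [real_inner_comm]
    simp [mul_comm]

/-! ### Kernel sections and discount weights -/

section RKHS

variable {X : Type*} (F : Type*) [NormedAddCommGroup F] [InnerProductSpace ℝ F]
  [CompleteSpace F] [RKHS ℝ F X ℝ]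

open scoped RealInnerProductSpace in
theorem rkhsKernel_eq_inner (x x' : X) :
    rkhsKernel F x x' = ⟪RKHS.kerFun F x (1 : ℝ), RKHS.kerFun F x' (1 : ℝ)⟫ := by
  rw [RKHS.kerFun_inner, RKHS.kerFun_apply]
  simp [rkhsKernel]

open scoped RealInnerProductSpace in
theorem apply_eq_inner_kerFun (f : F) (x : X) : f x = ⟪RKHS.kerFun F x (1 : ℝ), f⟫ := by
  rw [RKHS.kerFun_inner]
  simp

end RKHS

theorem discountWeight_fin (α : ℕ → ℝ) {n : ℕ} (i : Fin (n + 1)) :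
    discountWeight (fun j : Fin (n + 1) => α j) i = discountWeight α i := by
  have h : Finset.Ioc 0 (i : ℕ) = (Finset.Ioc 0 i).map Fin.valEmbedding :=
    (Fin.map_valEmbedding_Ioc 0 i).symm
  rw [discountWeight, discountWeight, h, Finset.prod_map]
  rfl

theorem discountWeight_pos {α : ℕ → ℝ} (hα : ∀ t, α t ∈ Set.Ioc (0 : ℝ) 1) (n : ℕ) :
    0 < discountWeight α n :=
  Finset.prod_pos fun i _ => inv_pos.2 (hα i).1

/-- The one place where `α ≤ 1` enters; it lets the ridge parameter grow between rounds. -/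
theorem discountWeight_le_succ {α : ℕ → ℝ} (hα : ∀ t, α t ∈ Set.Ioc (0 : ℝ) 1) (n : ℕ) :
    discountWeight α n ≤ discountWeight α (n + 1) := by
  have h : discountWeight α (n + 1) = discountWeight α n * (α (n + 1))⁻¹ :=
    Finset.prod_Ioc_succ_top (Nat.zero_le n) _
  rw [h]
  exact le_mul_of_one_le_right (discountWeight_pos hα n).le
    ((one_le_inv₀ (hα (n + 1)).1).2 (hα (n + 1)).2)

/-! ### Loss bounds for the kernel strategy -/

open scoped RealInnerProductSpace in
/-- The prediction of the kernel strategy is the value at the current input of the ridge regression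
in which the unknown outcome is replaced by the centre of the outcome set. -/
theorem kernelStrategy_predict_eq {X : Type*} (F : Type*) [NormedAddCommGroup F]
    [InnerProductSpace ℝ F] [CompleteSpace F] [RKHS ℝ F X ℝ] (Y₁ Y₂ : ℝ) {a : ℝ} (ha : 0 < a)
    {α : ℕ → ℝ} (hα : ∀ t, α t ∈ Set.Ioc (0 : ℝ) 1) (x : ℕ → X) (y : ℕ → ℝ) (n : ℕ) :
    ∃ g : F, (kernelStrategy (rkhsKernel F) Y₁ Y₂ a).predict α x y n =
        ⟪RKHS.kerFun F (x n) (1 : ℝ), g⟫ ∧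
      (a * discountWeight α n) • g =
        ∑ t ∈ Finset.range n, (discountWeight α t * (y t - ⟪RKHS.kerFun F (x t) (1 : ℝ), g⟫)) •
            RKHS.kerFun F (x t) (1 : ℝ) +
          (discountWeight α n * ((Y₁ + Y₂) / 2 - ⟪RKHS.kerFun F (x n) (1 : ℝ), g⟫)) •
            RKHS.kerFun F (x n) (1 : ℝ) := by
  have hpos := discountWeight_pos hα
  obtain ⟨g, hg, hpred⟩ := exists_ridge_of_gram
    (fun i : Fin (n + 1) => RKHS.kerFun F (x i) (1 : ℝ))
    (fun i => √(discountWeight α i / discountWeight α n))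
    (Fin.snoc (α := fun _ => ℝ) (fun i : Fin n => y i) ((Y₁ + Y₂) / 2)) ha
    (RKHS.kerFun F (x n) (1 : ℝ))
  refine ⟨g, ?_, ?_⟩
  · rw [← hpred]
    simp only [RegressionStrategy.predict, kernelStrategy, discountWeight_fin, Fin.val_last,
      rkhsKernel_eq_inner]
  · rw [mul_comm, mul_smul, hg, Fin.sum_univ_castSucc, smul_add, Finset.smul_sum]
    simp only [Real.sq_sqrt (div_nonneg (hpos _).le (hpos _).le), Fin.snoc_castSucc, Fin.snoc_last,
      Fin.val_castSucc, Fin.val_last, smul_smul, ← mul_assoc, mul_div_cancel₀ _ (hpos n).ne']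
    rw [← Fin.sum_univ_eq_sum_range (fun t => (discountWeight α t *
      (y t - ⟪RKHS.kerFun F (x t) (1 : ℝ), g⟫)) • RKHS.kerFun F (x t) (1 : ℝ))]

/-- The loss bound of the kernel strategy, in unnormalized form. -/
theorem kernelStrategy_weighted_loss_le {X : Type*} (F : Type*) [NormedAddCommGroup F]
    [InnerProductSpace ℝ F] [CompleteSpace F] [RKHS ℝ F X ℝ] {C : ℝ}
    (hC : ∀ x : X, rkhsKernel F x x ≤ C) {Y₁ Y₂ a : ℝ} (ha : 0 < a)
    {α : ℕ → ℝ} (hα : ∀ t, α t ∈ Set.Ioc (0 : ℝ) 1) (x : ℕ → X) {y : ℕ → ℝ}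
    (hy : ∀ t, y t ∈ Set.Icc Y₁ Y₂) (n : ℕ) (f : F) :
    ∑ t ∈ Finset.range n, discountWeight α t *
        ((kernelStrategy (rkhsKernel F) Y₁ Y₂ a).predict α x y t - y t) ^ 2 ≤
      ∑ t ∈ Finset.range n, discountWeight α t * (f (x t) - y t) ^ 2 +
        a * discountWeight α (n - 1) * ‖f‖ ^ 2 +
          (Y₂ - Y₁) ^ 2 / 4 * (C / a) * ∑ t ∈ Finset.range n, discountWeight α t := by
  have hpos := discountWeight_pos hα
  induction n generalizing f with
  | zero => simpa using mul_nonneg (mul_nonneg ha.le (hpos 0).le) (sq_nonneg ‖f‖)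
  | succ n ih =>
    obtain ⟨g, hpred, hg⟩ := kernelStrategy_predict_eq F Y₁ Y₂ ha hα x y n
    -- At `n = 0` the truncated `n - 1` is `0`, so the first round has equality.
    have hmono : discountWeight α (n - 1) ≤ discountWeight α n := by
      cases n with
      | zero => rfl
      | succ n => exact discountWeight_le_succ hα n
    have hD : (y n - (Y₁ + Y₂) / 2) ^ 2 ≤ (Y₂ - Y₁) ^ 2 / 4 := by
      nlinarith [mul_nonneg (sub_nonneg.2 (hy n).1) (sub_nonneg.2 (hy n).2)]
    have hstep := aggregating_step (Finset.range n) (discountWeight α) y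
      (fun t => RKHS.kerFun F (x t) (1 : ℝ)) (fun t _ => (hpos t).le)
      (mul_pos ha (hpos n)) (hpos n).le
      ((rkhsKernel_eq_inner F (x n) (x n)).symm.trans_le (hC (x n))) hD hg
      (S := ∑ t ∈ Finset.range n, discountWeight α t *
        ((kernelStrategy (rkhsKernel F) Y₁ Y₂ a).predict α x y t - y t) ^ 2 -
          (Y₂ - Y₁) ^ 2 / 4 * (C / a) * ∑ t ∈ Finset.range n, discountWeight α t)
      (fun h => by
        have h1 : a * discountWeight α (n - 1) * ‖h‖ ^ 2 ≤ a * discountWeight α n * ‖h‖ ^ 2 := by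
          gcongr
        rw [real_inner_self_eq_norm_sq]
        simp only [← apply_eq_inner_kerFun]
        linarith [ih h]) f
    rw [← hpred, real_inner_self_eq_norm_sq] at hstep
    simp only [← apply_eq_inner_kerFun] at hstep
    have hlast : discountWeight α n ^ 2 * (C / (a * discountWeight α n)) =
        C / a * discountWeight α n := by
      have := (hpos n).ne'
      field_simp
    rw [hlast] at hstep
    rw [Finset.sum_range_succ, Finset.sum_range_succ _ n, Finset.sum_range_succ _ n,
      Nat.add_sub_cancel]
    linarith

/-- The loss bound of the kernel strategy for an arbitrary regularization parameter. -/
theorem kernelStrategy_discountedSquareLoss_le {X : Type*} (F : Type*) [NormedAddCommGroup F]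
    [InnerProductSpace ℝ F] [CompleteSpace F] [RKHS ℝ F X ℝ] {C : ℝ}
    (hC : ∀ x : X, rkhsKernel F x x ≤ C) {Y₁ Y₂ a : ℝ} (ha : 0 < a)
    {α : ℕ → ℝ} (hα : ∀ t, α t ∈ Set.Ioc (0 : ℝ) 1) (x : ℕ → X) {y : ℕ → ℝ}
    (hy : ∀ t, y t ∈ Set.Icc Y₁ Y₂) (N : ℕ) (f : F) :
    discountedSquareLoss α ((kernelStrategy (rkhsKernel F) Y₁ Y₂ a).predict α x y) y N ≤
      discountedSquareLoss α (fun t => f (x t)) y N + a * ‖f‖ ^ 2 + (Y₂ - Y₁) ^ 2 / 4 *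
        (C / a) * ((∑ t ∈ Finset.range (N + 1), discountWeight α t) / discountWeight α N) := by
  have hN := discountWeight_pos hα N
  have hdiv : ∀ p : ℕ → ℝ, discountedSquareLoss α p y N =
      (∑ t ∈ Finset.range (N + 1), discountWeight α t * (p t - y t) ^ 2) / discountWeight α N := by
    intro p
    rw [discountedSquareLoss, Finset.sum_div]
    exact Finset.sum_congr rfl fun t _ => by ring
  have h := kernelStrategy_weighted_loss_le F hC ha hα x hy (N + 1) f
  rw [Nat.add_sub_cancel] at h
  rw [hdiv, hdiv, div_le_iff₀ hN]
  refine h.trans_eq ?_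
  field_simp

theorem corollary1 {X : Type*} (F : Type*) [NormedAddCommGroup F] [InnerProductSpace ℝ F]
    [CompleteSpace F] [RKHS ℝ F X ℝ]
    (hk : BddAbove (Set.range fun x : X => rkhsKernel F x x))
    (c : ℝ) (hc : c = √(⨆ x : X, rkhsKernel F x x))
    (Y₁ Y₂ : ℝ) (𝒯 : ℝ) (h𝒯 : 0 < 𝒯) :
    ∃ a : ℝ, 0 < a ∧ (0 < c → a = c * √𝒯) ∧
      ∀ (α : ℕ → ℝ) (x : ℕ → X) (y : ℕ → ℝ),
        (∀ t, α t ∈ Set.Ioc (0 : ℝ) 1) → (∀ t, y t ∈ Set.Icc Y₁ Y₂) →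
        ∀ N : ℕ, (∑ t ∈ Finset.range (N + 1), discountWeight α t) / discountWeight α N ≤ 𝒯 →
          ∀ f : F,
            discountedSquareLoss α ((kernelStrategy (rkhsKernel F) Y₁ Y₂ a).predict α x y) y N ≤
              discountedSquareLoss α (fun t => f (x t)) y N +
                ((Y₂ - Y₁) ^ 2 / 4 + ‖f‖ ^ 2) * (c * √𝒯) := by
  have hdiag : ∀ x : X, 0 ≤ rkhsKernel F x x := fun x => by
    rw [rkhsKernel_eq_inner]; exact real_inner_self_nonneg
  have hC : ∀ x : X, rkhsKernel F x x ≤ c ^ 2 := fun x => by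
    rw [hc, Real.sq_sqrt (Real.iSup_nonneg hdiag)]
    exact le_ciSup hk x
  have hc0 : 0 ≤ c := hc ▸ Real.sqrt_nonneg _
  rcases hc0.eq_or_lt with rfl | hcpos
  -- If `c = 0`, every function in `F` vanishes, so any `a > 0` works and comparison with `0`
  -- suffices.
  · refine ⟨1, one_pos, fun h => (lt_irrefl _ h).elim, fun α x y hα hy N _ f => ?_⟩
    have hzero : ∀ (h : F) (z : X), h z = 0 := fun h z => by
      have h1 : rkhsKernel F z z = 0 := le_antisymm (by simpa using hC z) (hdiag z)
      rw [rkhsKernel_eq_inner, inner_self_eq_zero] at h1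
      rw [apply_eq_inner_kerFun, h1, inner_zero_left]
    have h := kernelStrategy_discountedSquareLoss_le F hC one_pos hα x hy N (0 : F)
    simp only [hzero] at h ⊢
    simpa using h
  · have hs : 0 < √𝒯 := Real.sqrt_pos.2 h𝒯
    refine ⟨c * √𝒯, mul_pos hcpos hs, fun _ => rfl, fun α x y hα hy N hN f => ?_⟩
    have h := kernelStrategy_discountedSquareLoss_le F hC (mul_pos hcpos hs) hα x hy N f
    have h1 : (Y₂ - Y₁) ^ 2 / 4 * (c ^ 2 / (c * √𝒯)) *
          ((∑ t ∈ Finset.range (N + 1), discountWeight α t) / discountWeight α N) ≤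
        (Y₂ - Y₁) ^ 2 / 4 * (c ^ 2 / (c * √𝒯)) * 𝒯 := by gcongr
    have h2 : c ^ 2 / (c * √𝒯) * 𝒯 = c * √𝒯 := by
      rw [div_mul_eq_mul_div, div_eq_iff (mul_pos hcpos hs).ne']
      linear_combination -c ^ 2 * Real.sq_sqrt h𝒯.le
    rw [mul_assoc _ _ 𝒯, h2] at h1
    linarith
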